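/- Consider a chain of $N\ge 1$ linear hyperbolic subsystems. For $i\in\{1,\dots,N\}$, $t>0$, $x\in[0,1]$, the states $u_i(t,x)\in\mathbb{R}^{n_i}$ and $v_i(t,x)\in\mathbb{R}^{m_i}$ ($n_i,m_i\ge1$) satisfy $$\partial_t u_i+\Lambda_i^+\partial_x u_i=\Sigma_i^{++}(x)u_i+\Sigma_i^{+-}(x)v_i,\qquad \partial_t v_i-\Lambda_i^-\partial_x v_i=\Sigma_i^{-+}(x)u_i+\Sigma_i^{--}(x)v_i,$$ $$u_i(t,0)=Q_{i,i}v_i(t,0)+Q_{i,i-1}u_{i-1}(t,1),\qquad v_i(t,1)=R_{i,i}u_i(t,1)+R_{i,i+1}v_{i+1}(t,0),$$ where $\Lambda_i^+=\mathrm{diag}(\lambda_i^1,\dots,\lambda_i^{n_i})$ with $0<\lambda_i^1<\dots<\lambda_i^{n_i}$, $\Lambda_i^-=\mathrm{diag}(\mu_i^1,\dots,\mu_i^{m_i})$ with $0<\mu_i^1<\dots<\mu_i^{m_i}$, the matrix functions $\Sigma_i^{\cdot\cdot}$ are continuous on $[0,1]$, and the matrices $Q_{i,j},R_{i,j}$ are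 constant. By convention $R_{N,N+1}=0$, $Q_{1,0}=\mathrm{Id}$, and $u_0(t,1)=U(t)\in\mathbb{R}^{n_1}$ is the control input. The boundary conditions hold for all $t\ge0$. A solution is understood in the class $C^0([0,\infty);H^1([0,1]))\cap C^1((0,\infty);L^2([0,1]))$, the differential equations holding in $L^2([0,1])$ for every $t>0$. The measured output is $y(t)=u_N(t,1)$. Assume that $\operatorname{rank}Q_{i,i-1}=n_{i-1}$ for all $i\in\{2,\dots,N\}$. Let $\tau>\sum_{j=1}^N 1/\lambda_j^1$ be a fixed delay, and write $\bar u_i(t,x)=u_i(t-\tau,x)$ and $\bar v_i(t,x)=v_i(t-\tau,x)$. Then there are state estimators $\hat u=(\hat u_i)_{1\le i\le N}$ and $\hat v=(\hat v_i)_{1\le i\le N}$, i.e. maps sending an output signal $y$ to functions $\hat u_i(t,x)\in\mathbb{R}^{n_i}$ and $\hat v_i(t,x)\in\mathbb{R}^{m_i}$, which depend only on the coefficients of the system and on $\tau$, and which are causal (their values at time $t$ depend only on the restriction of $y$ to $[0,t]$), such that for every control input $U$ and every solution $(u_i,v_i)_{1\le i\le N}$ of the system, with output $y$, the estimators applied to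 $y$ satisfy $$\hat u_i(t,x)=\bar u_i(t,x)\quad\text{and}\quad\hat v_i(t,x)=\bar v_i(t,x)$$ for all $i\in\{1,\dots,N\}$, all $x\in[0,1]$ and all $t\ge\tau+\sum_{j=i}^N 1/\mu_j^1$. -/

import Mathlib

open Set Filter Topology MeasureTheory
open scoped Matrix

noncomputable section

/-- Data of a chain of `N ≥ 1` linear hyperbolic subsystems.  Subsystem `i` has `n i` components
travelling to the right with speeds `lam i 0 < lam i 1 < ⋯` and `m i` components travelling to the
left with speeds `mu i 0 < mu i 1 < ⋯`.  Subsystems are numbered `0, …, N - 1`.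
Of the matrices `Q i j` only those with `j = i - 1` are used, of the matrices `R i j` only those
with `j = i + 1`. -/
structure HyperbolicChain where
  N : ℕ
  N_pos : 0 < N
  n : Fin N → ℕ
  m : Fin N → ℕ
  n_pos : ∀ i, 0 < n i
  m_pos : ∀ i, 0 < m i
  /-- rightward transport velocities -/
  lam : ∀ i, Fin (n i) → ℝ
  lam_pos : ∀ i k, 0 < lam i k
  lam_strictMono : ∀ i, StrictMono (lam i)
  /-- leftward transport velocities -/
  mu : ∀ i, Fin (m i) → ℝ
  mu_pos : ∀ i k, 0 < mu i k
  mu_strictMono : ∀ i, StrictMono (mu i)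
  /-- in-domain couplings, continuous on `[0,1]` -/
  Spp : ∀ i, ℝ → Matrix (Fin (n i)) (Fin (n i)) ℝ
  Spm : ∀ i, ℝ → Matrix (Fin (n i)) (Fin (m i)) ℝ
  Smp : ∀ i, ℝ → Matrix (Fin (m i)) (Fin (n i)) ℝ
  Smm : ∀ i, ℝ → Matrix (Fin (m i)) (Fin (m i)) ℝ
  Spp_cont : ∀ i, ContinuousOn (Spp i) (Icc 0 1)
  Spm_cont : ∀ i, ContinuousOn (Spm i) (Icc 0 1)
  Smp_cont : ∀ i, ContinuousOn (Smp i) (Icc 0 1)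
  Smm_cont : ∀ i, ContinuousOn (Smm i) (Icc 0 1)
  /-- coupling of the left ends: `Qd i` is `Q_{i,i}`, `Q i j` is `Q_{i,j}` for `j = i - 1` -/
  Qd : ∀ i, Matrix (Fin (n i)) (Fin (m i)) ℝ
  Q : ∀ i j, Matrix (Fin (n i)) (Fin (n j)) ℝ
  /-- coupling of the right ends: `Rd i` is `R_{i,i}`, `R i j` is `R_{i,j}` for `j = i + 1` -/
  Rd : ∀ i, Matrix (Fin (m i)) (Fin (n i)) ℝ
  R : ∀ i j, Matrix (Fin (m i)) (Fin (m j)) ℝ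

/-- `g t` is the (weak) derivative of `f t ∈ H¹([0,1])` for every `t ≥ 0`, and
`t ↦ f t` is continuous from `[0,∞)` to `H¹([0,1])`.  `H¹([0,1])` is the space of
absolutely continuous functions with square integrable derivative. -/
structure IsContinuousInH1 (f g : ℝ → ℝ → ℝ) : Prop where
  memLp : ∀ t, 0 ≤ t → MemLp (g t) 2 (volume.restrict (Icc (0 : ℝ) 1))
  eq_integral : ∀ t, 0 ≤ t → ∀ x ∈ Icc (0 : ℝ) 1, f t x = f t 0 + ∫ ξ in (0 : ℝ)..x, g t ξ
  continuous : ∀ t, 0 ≤ t →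
    Tendsto (fun s => eLpNorm (fun x => f s x - f t x) 2 (volume.restrict (Icc (0 : ℝ) 1)))
      (𝓝[Ici 0] t) (𝓝 0)
  continuous_deriv : ∀ t, 0 ≤ t →
    Tendsto (fun s => eLpNorm (fun x => g s x - g t x) 2 (volume.restrict (Icc (0 : ℝ) 1)))
      (𝓝[Ici 0] t) (𝓝 0)

/-- For every `t > 0`, `h t` is the derivative at `t` of `t ↦ f t`, as a map into `L²([0,1])`. -/
def HasTimeDerivInL2 (f h : ℝ → ℝ → ℝ) : Prop :=
  ∀ t, 0 < t →
    Tendsto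
      (fun s => eLpNorm (fun x => (s - t)⁻¹ * (f s x - f t x) - h t x) 2
        (volume.restrict (Icc (0 : ℝ) 1)))
      (𝓝[≠] t) (𝓝 0)

namespace HyperbolicChain

variable (S : HyperbolicChain)

/-- The first subsystem, on which the control acts. -/
def first : Fin S.N := ⟨0, S.N_pos⟩

/-- The last subsystem, at which the measurement is taken. -/
def last : Fin S.N := ⟨S.N - 1, Nat.sub_lt S.N_pos Nat.one_pos⟩

/-- The smallest rightward velocity of subsystem `i`. -/
def lamMin (i : Fin S.N) : ℝ := S.lam i ⟨0, S.n_pos i⟩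

/-- The smallest leftward velocity of subsystem `i`. -/
def muMin (i : Fin S.N) : ℝ := S.mu i ⟨0, S.m_pos i⟩

/-- Families of rightward states: `u i t x` is the vector `u_i(t,x)`. -/
abbrev RightState : Type := ∀ i : Fin S.N, ℝ → ℝ → Fin (S.n i) → ℝ

/-- Families of leftward states: `v i t x` is the vector `v_i(t,x)`. -/
abbrev LeftState : Type := ∀ i : Fin S.N, ℝ → ℝ → Fin (S.m i) → ℝ

/-- Output signals. -/
abbrev Signal : Type := ℝ → Fin (S.n S.last) → ℝ

/-- `(u, v)` is a solution of the interconnected system with control input `U`, in the class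
`C⁰([0,∞); H¹) ∩ C¹((0,∞); L²)`.  The initial state is `(u · 0, v · 0)`; it is in `H¹`, and the
boundary conditions at `t = 0` are its compatibility conditions. -/
structure IsSolution (U : ℝ → Fin (S.n S.first) → ℝ) (u : S.RightState) (v : S.LeftState) :
    Prop where
  /-- `∂ₜ u_i + Λ_i⁺ ∂ₓ u_i = Σ_i⁺⁺ u_i + Σ_i⁺⁻ v_i` -/
  pde_u : ∀ (i : Fin S.N) (k : Fin (S.n i)), ∃ ux : ℝ → ℝ → ℝ,
    IsContinuousInH1 (fun t x => u i t x k) ux ∧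
    HasTimeDerivInL2 (fun t x => u i t x k)
      (fun t x => -(S.lam i k) * ux t x
        + (S.Spp i x *ᵥ u i t x + S.Spm i x *ᵥ v i t x) k)
  /-- `∂ₜ v_i - Λ_i⁻ ∂ₓ v_i = Σ_i⁻⁺ u_i + Σ_i⁻⁻ v_i` -/
  pde_v : ∀ (i : Fin S.N) (k : Fin (S.m i)), ∃ vx : ℝ → ℝ → ℝ,
    IsContinuousInH1 (fun t x => v i t x k) vx ∧
    HasTimeDerivInL2 (fun t x => v i t x k)
      (fun t x => S.mu i k * vx t x
        + (S.Smp i x *ᵥ u i t x + S.Smm i x *ᵥ v i t x) k)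
  /-- the control enters the first subsystem -/
  bc_u_first : ∀ t, 0 ≤ t →
    u S.first t 0 = S.Qd S.first *ᵥ v S.first t 0 + U t
  bc_u : ∀ i j : Fin S.N, i.val = j.val + 1 → ∀ t, 0 ≤ t →
    u i t 0 = S.Qd i *ᵥ v i t 0 + S.Q i j *ᵥ u j t 1
  bc_v : ∀ i j : Fin S.N, j.val = i.val + 1 → ∀ t, 0 ≤ t →
    v i t 1 = S.Rd i *ᵥ u i t 1 + S.R i j *ᵥ v j t 0
  bc_v_last : ∀ t, 0 ≤ t →
    v S.last t 1 = S.Rd S.last *ᵥ u S.last t 1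

/-- The measurement `y(t) = u_N(t,1)`. -/
def output (u : S.RightState) : S.Signal := fun t => u S.last t 1

/-- The estimator `E`, a map from output signals to families of functions of `(t,x)`, is causal:
its value at time `t` depends only on the values of the output signal on `[0,t]`. -/
def IsCausal {d : Fin S.N → ℕ} (E : S.Signal → ∀ i : Fin S.N, ℝ → ℝ → Fin (d i) → ℝ) : Prop :=
  ∀ (y y' : S.Signal) (t : ℝ), (∀ s ∈ Icc 0 t, y s = y' s) →
    ∀ i, ∀ x ∈ Icc (0 : ℝ) 1, E y i t x = E y' i t x

end HyperbolicChain

/-- The `τ`-delay operator `γ ↦ γ̄`, `γ̄(t) = γ(t - τ)`. -/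
def delayed {α : Type*} (τ : ℝ) (γ : ℝ → α) : ℝ → α := fun t => γ (t - τ)

end

/-! The theorem is an observability statement: two solutions with the same output on `[0, t]` have
the same state at time `t - τ`. The estimator then needs no formula: at time `t` it picks any
trajectory that reproduces the output on `[0, t]` and reads it at time `t - τ`.

By linearity it suffices that a solution with zero output on an interval vanishes
(`eq_of_output_eq`). Inside one subsystem all speeds are nonzero, so `x` can serve as the evolution
variable: data that vanish at `x = 1` during `[a, b]` force the state to vanish on a trapezoid whose
sides have the extreme slopes `-1/μ` and `1/λ` (`eq_zero_of_eq_zero_right`). On the line `x = 0`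
this costs `1/μ` at the start and `1/λ` at the end of the interval. The condition at the left end
then gives `Q u = 0` for the right trace `u` of the preceding subsystem. Full column rank of `Q`
gives `u = 0`, and the condition at that right end gives `v = 0`. Induction from the last subsystem
to the first adds up the travel times (`right_end_eq_zero`).

Solutions have no pointwise derivatives, so integration along characteristics is replaced by a
balance law on moving windows (`hasDerivAt_integral_moving`), whose width is then sent to zero. -/

/-! ### Integrals and L² norms on the unit interval. -/

instance isProbabilityMeasure_restrict_unitInterval :
    IsProbabilityMeasure (volume.restrict (Icc (0 : ℝ) 1)) := ⟨by simp⟩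

theorem MeasureTheory.MemLp.intervalIntegrable_unitInterval {d : ℝ → ℝ}
    (hd : MemLp d 2 (volume.restrict (Icc (0 : ℝ) 1))) {a b : ℝ} (ha : a ∈ Icc (0 : ℝ) 1)
    (hb : b ∈ Icc (0 : ℝ) 1) : IntervalIntegrable d volume a b := by
  rw [intervalIntegrable_iff]
  have h : IntegrableOn d (Icc 0 1) := hd.integrable (by norm_num)
  exact h.mono_set (uIoc_subset_uIcc.trans (uIcc_subset_Icc ha hb))

/-- The interval has mass one, so the L¹ norm is at most the L² norm with no constant. -/
theorem abs_integral_le_eLpNorm_unitInterval {d : ℝ → ℝ}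
    (hd : MemLp d 2 (volume.restrict (Icc (0 : ℝ) 1))) {a b : ℝ} (ha : a ∈ Icc (0 : ℝ) 1)
    (hb : b ∈ Icc (0 : ℝ) 1) :
    |∫ x in a..b, d x| ≤ (eLpNorm d 2 (volume.restrict (Icc (0 : ℝ) 1))).toReal := by
  have h : IntegrableOn d (Icc 0 1) := hd.integrable (by norm_num)
  calc |∫ x in a..b, d x| ≤ ∫ x in uIoc a b, |d x| := by
        simpa using intervalIntegral.norm_integral_le_integral_norm_uIoc (f := d) (μ := volume)
    _ ≤ ∫ x in Icc 0 1, |d x| := by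
        refine setIntegral_mono_set h.abs (ae_of_all _ fun x => abs_nonneg _) ?_
        exact (uIoc_subset_uIcc.trans (uIcc_subset_Icc ha hb)).eventuallyLE
    _ = (eLpNorm d 1 (volume.restrict (Icc (0 : ℝ) 1))).toReal := by
        rw [eLpNorm_one_eq_lintegral_enorm, ← integral_norm_eq_lintegral_enorm
          h.aestronglyMeasurable]
        rfl
    _ ≤ _ := ENNReal.toReal_mono hd.eLpNorm_ne_top
        (eLpNorm_le_eLpNorm_of_exponent_le (by norm_num) h.aestronglyMeasurable)

theorem ContinuousOn.memLp_two_unitInterval {d : ℝ → ℝ} (hd : ContinuousOn d (Icc 0 1)) :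
    MemLp d 2 (volume.restrict (Icc (0 : ℝ) 1)) := by
  obtain ⟨C, hC⟩ := isCompact_Icc.exists_bound_of_continuousOn hd
  exact MemLp.of_bound (hd.aestronglyMeasurable measurableSet_Icc) C
    ((ae_restrict_iff' measurableSet_Icc).2 (ae_of_all _ hC))

theorem tendsto_toReal_eLpNorm {ι : Type*} {l : Filter ι} {d : ι → ℝ → ℝ}
    (h : Tendsto (fun s => eLpNorm (d s) 2 (volume.restrict (Icc (0 : ℝ) 1))) l (𝓝 0)) :
    Tendsto (fun s => (eLpNorm (d s) 2 (volume.restrict (Icc (0 : ℝ) 1))).toReal) l (𝓝 0) := by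
  exact (ENNReal.tendsto_toReal ENNReal.zero_ne_top).comp h

/-! ### Joint continuity in time and space, and balance laws on moving windows. -/

namespace IsContinuousInH1

variable {f g : ℝ → ℝ → ℝ}

theorem sub_eq_integral (hf : IsContinuousInH1 f g) {t : ℝ} (ht : 0 ≤ t) {x y : ℝ}
    (hx : x ∈ Icc (0 : ℝ) 1) (hy : y ∈ Icc (0 : ℝ) 1) :
    f t x - f t y = ∫ ξ in y..x, g t ξ := by
  have h0 : (0 : ℝ) ∈ Icc (0 : ℝ) 1 := by simp
  rw [hf.eq_integral t ht x hx, hf.eq_integral t ht y hy, add_sub_add_left_eq_sub]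
  exact intervalIntegral.integral_interval_sub_left
    ((hf.memLp t ht).intervalIntegrable_unitInterval h0 hx)
    ((hf.memLp t ht).intervalIntegrable_unitInterval h0 hy)

theorem continuousOn_section (hf : IsContinuousInH1 f g) {t : ℝ} (ht : 0 ≤ t) :
    ContinuousOn (f t) (Icc 0 1) := by
  have h : IntegrableOn (g t) (Icc 0 1) := (hf.memLp t ht).integrable (by norm_num)
  have h1 := intervalIntegral.continuousOn_primitive_interval (μ := volume) (f := g t) (a := 0)
    (b := 1) (by rwa [uIcc_of_le zero_le_one])
  rw [uIcc_of_le zero_le_one] at h1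
  exact (continuousOn_const.add h1).congr fun x hx => hf.eq_integral t ht x hx

/-- The embedding of `H¹` into `C⁰` bounds the increments in time uniformly in space. -/
theorem abs_sub_le (hf : IsContinuousInH1 f g) {s t : ℝ} (hs : 0 ≤ s) (ht : 0 ≤ t) {x : ℝ}
    (hx : x ∈ Icc (0 : ℝ) 1) :
    |f s x - f t x| ≤
      (eLpNorm (fun x => f s x - f t x) 2 (volume.restrict (Icc (0 : ℝ) 1))).toReal
      + (eLpNorm (fun x => g s x - g t x) 2 (volume.restrict (Icc (0 : ℝ) 1))).toReal := by
  have h0 : (0 : ℝ) ∈ Icc (0 : ℝ) 1 := by simp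
  have h1 : (1 : ℝ) ∈ Icc (0 : ℝ) 1 := by simp
  have hd : ContinuousOn (fun x => f s x - f t x) (Icc 0 1) :=
    (hf.continuousOn_section hs).sub (hf.continuousOn_section ht)
  -- The increment at `x` differs from the one at any `y` by at most the norm of the derivative;
  -- averaging over `y` gives the claim.
  have key : ∀ y ∈ Icc (0 : ℝ) 1, |f s x - f t x| -
      (eLpNorm (fun x => g s x - g t x) 2 (volume.restrict (Icc (0 : ℝ) 1))).toReal
      ≤ |f s y - f t y| := by
    intro y hy
    have e : (f s x - f t x) - (f s y - f t y) = ∫ ξ in y..x, (g s ξ - g t ξ) := by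
      rw [intervalIntegral.integral_sub ((hf.memLp s hs).intervalIntegrable_unitInterval hy hx)
        ((hf.memLp t ht).intervalIntegrable_unitInterval hy hx), ← hf.sub_eq_integral hs hx hy,
        ← hf.sub_eq_integral ht hx hy]
      ring
    have := abs_integral_le_eLpNorm_unitInterval ((hf.memLp s hs).sub (hf.memLp t ht)) hy hx
    simp only [Pi.sub_def] at this
    rw [← e] at this
    linarith [abs_sub_abs_le_abs_sub (f s x - f t x) (f s y - f t y)]
  have h2 := intervalIntegral.integral_mono_on (μ := volume) zero_le_one
    (intervalIntegrable_const) (hd.abs.memLp_two_unitInterval.intervalIntegrable_unitInterval h0 h1)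
    key
  have h3 := abs_integral_le_eLpNorm_unitInterval hd.abs.memLp_two_unitInterval h0 h1
  have h4 : eLpNorm (fun x => |f s x - f t x|) 2 (volume.restrict (Icc (0 : ℝ) 1))
      = eLpNorm (fun x => f s x - f t x) 2 (volume.restrict (Icc (0 : ℝ) 1)) :=
    eLpNorm_norm (fun x => f s x - f t x)
  rw [h4] at h3
  simp only [intervalIntegral.integral_const, sub_zero, smul_eq_mul, one_mul] at h2
  linarith [le_abs_self (∫ x in (0 : ℝ)..1, |f s x - f t x|)]

theorem continuousOn_uncurry (hf : IsContinuousInH1 f g) :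
    ContinuousOn (fun p : ℝ × ℝ => f p.1 p.2) (Ici 0 ×ˢ Icc 0 1) := by
  rintro ⟨t, x⟩ ⟨ht, hx⟩
  rw [mem_Ici] at ht
  have hfst : Tendsto Prod.fst (𝓝[Ici 0 ×ˢ Icc (0 : ℝ) 1] (t, x)) (𝓝[Ici 0] t) := by
    rw [nhdsWithin_prod_eq]; exact tendsto_fst
  have hsnd : Tendsto Prod.snd (𝓝[Ici 0 ×ˢ Icc (0 : ℝ) 1] (t, x)) (𝓝[Icc 0 1] x) := by
    rw [nhdsWithin_prod_eq]; exact tendsto_snd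
  have hN := ((tendsto_toReal_eLpNorm (hf.continuous t ht)).add
    (tendsto_toReal_eLpNorm (hf.continuous_deriv t ht))).comp hfst
  have h1 : Tendsto (fun p : ℝ × ℝ => f p.1 p.2 - f t p.2) (𝓝[Ici 0 ×ˢ Icc (0 : ℝ) 1] (t, x))
      (𝓝 0) := by
    refine squeeze_zero_norm' ?_ (by simpa using hN)
    filter_upwards [self_mem_nhdsWithin] with p hp
    exact hf.abs_sub_le hp.1 ht hp.2
  have h2 := ((hf.continuousOn_section ht) x hx).tendsto.comp hsnd
  simpa [ContinuousWithinAt] using h1.add h2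

/-- Split `f s = (f s - f t) + f t`. The first integral is differentiated by L² convergence of the
difference quotients, the second by the fundamental theorem of calculus at the moving endpoint. The
flux `c f` at that endpoint cancels, which leaves the source and the inflow at `0`. -/
theorem hasDerivAt_integral_zero_moving (hf : IsContinuousInH1 f g) {c : ℝ} {F : ℝ → ℝ → ℝ}
    (hF : ∀ t, 0 ≤ t → ContinuousOn (F t) (Icc 0 1))
    (hft : HasTimeDerivInL2 f fun t x => -c * g t x + F t x)
    {t : ℝ} (ht : 0 < t) {a : ℝ} (ha : a + c * t ∈ Ioo (0 : ℝ) 1) :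
    HasDerivAt (fun s => ∫ x in (0 : ℝ)..(a + c * s), f s x)
      (c * f t 0 + ∫ x in (0 : ℝ)..(a + c * t), F t x) t := by
  have h0 : (0 : ℝ) ∈ Icc (0 : ℝ) 1 := by simp
  have hX : HasDerivAt (fun s => a + c * s) c t := by
    simpa using ((hasDerivAt_id t).const_mul c).const_add a
  have hXmem : ∀ᶠ s in 𝓝 t, a + c * s ∈ Icc (0 : ℝ) 1 := by
    filter_upwards [hX.continuousAt.eventually_mem (isOpen_Ioo.mem_nhds ha)] with s hs
    exact Ioo_subset_Icc_self hs
  have hpos : ∀ᶠ s in 𝓝 t, 0 < s := lt_mem_nhds ht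
  have hcont := hf.continuousOn_section ht.le
  have hh : MemLp (fun x => -c * g t x + F t x) 2 (volume.restrict (Icc (0 : ℝ) 1)) :=
    ((hf.memLp t ht.le).const_mul (-c)).add (hF t ht.le).memLp_two_unitInterval
  have hint : ∀ s, 0 ≤ s → ∀ y ∈ Icc (0 : ℝ) 1, IntervalIntegrable (f s) volume 0 y :=
    fun s hs y hy =>
      (hf.continuousOn_section hs).memLp_two_unitInterval.intervalIntegrable_unitInterval h0 hy
  have hspace : HasDerivAt (fun s => ∫ x in (0 : ℝ)..(a + c * s), f t x) (f t (a + c * t) * c) t :=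
    HasDerivAt.comp (h₂ := fun y => ∫ x in (0 : ℝ)..y, f t x) t
      (intervalIntegral.integral_hasDerivAt_right (hint t ht.le _ (Ioo_subset_Icc_self ha))
      ((hcont.mono Ioo_subset_Icc_self).stronglyMeasurableAtFilter isOpen_Ioo _ ha)
      (hcont.continuousAt (Icc_mem_nhds ha.1 ha.2))) hX
  have htime : HasDerivAt (fun s => ∫ x in (0 : ℝ)..(a + c * s), (f s x - f t x))
      (∫ x in (0 : ℝ)..(a + c * t), (-c * g t x + F t x)) t := by
    rw [hasDerivAt_iff_tendsto_slope]
    have hprim : Tendsto (fun s => ∫ x in (0 : ℝ)..(a + c * s), (-c * g t x + F t x)) (𝓝[≠] t)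
        (𝓝 (∫ x in (0 : ℝ)..(a + c * t), (-c * g t x + F t x))) := by
      have h1 := intervalIntegral.continuousOn_primitive_interval (μ := volume)
        (f := fun x => -c * g t x + F t x) (a := 0) (b := 1)
        (by rw [uIcc_of_le zero_le_one]; exact hh.integrable (by norm_num))
      rw [uIcc_of_le zero_le_one] at h1
      exact ((h1.continuousAt (Icc_mem_nhds ha.1 ha.2)).tendsto.comp
        hX.continuousAt.tendsto).mono_left nhdsWithin_le_nhds
    have herr : Tendsto (fun s => ∫ x in (0 : ℝ)..(a + c * s),
        ((s - t)⁻¹ * (f s x - f t x) - (-c * g t x + F t x))) (𝓝[≠] t) (𝓝 0) := by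
      refine squeeze_zero_norm' ?_ (tendsto_toReal_eLpNorm (hft t ht))
      filter_upwards [hXmem.filter_mono nhdsWithin_le_nhds,
        hpos.filter_mono nhdsWithin_le_nhds] with s hs hs0
      refine abs_integral_le_eLpNorm_unitInterval (MemLp.sub ?_ hh) h0 hs
      exact ((hf.continuousOn_section hs0.le).sub hcont).memLp_two_unitInterval.const_mul _
    have := herr.add hprim
    rw [zero_add] at this
    refine this.congr' ?_
    filter_upwards [hXmem.filter_mono nhdsWithin_le_nhds,
        hpos.filter_mono nhdsWithin_le_nhds] with s hs hs0
    have hq : IntervalIntegrable (fun x => (s - t)⁻¹ * (f s x - f t x)) volume 0 (a + c * s) :=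
      ((hint s hs0.le _ hs).sub (hint t ht.le _ hs)).const_mul _
    rw [← intervalIntegral.integral_add
      (hq.sub (hh.intervalIntegrable_unitInterval h0 hs)) (hh.intervalIntegrable_unitInterval h0 hs)]
    simp [slope_def_field, div_eq_inv_mul]
  have hval : c * f t 0 + ∫ x in (0 : ℝ)..(a + c * t), F t x
      = (∫ x in (0 : ℝ)..(a + c * t), (-c * g t x + F t x)) + f t (a + c * t) * c := by
    rw [intervalIntegral.integral_add
      (((hf.memLp t ht.le).const_mul (-c)).intervalIntegrable_unitInterval h0
        (Ioo_subset_Icc_self ha))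
      ((hF t ht.le).memLp_two_unitInterval.intervalIntegrable_unitInterval h0
        (Ioo_subset_Icc_self ha)), intervalIntegral.integral_const_mul,
      ← hf.sub_eq_integral ht.le (Ioo_subset_Icc_self ha) h0]
    ring
  rw [hval]
  refine (htime.add hspace).congr_of_eventuallyEq ?_
  filter_upwards [hXmem, hpos] with s hs hs0
  simp only [Pi.add_apply]
  rw [intervalIntegral.integral_sub (hint s hs0.le _ hs) (hint t ht.le _ hs)]
  ring

/-- Balance law on a window that moves with the speed `c` of transport: the mass of the window
changes only by the source term. -/
theorem hasDerivAt_integral_moving (hf : IsContinuousInH1 f g) {c : ℝ} {F : ℝ → ℝ → ℝ}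
    (hF : ∀ t, 0 ≤ t → ContinuousOn (F t) (Icc 0 1))
    (hft : HasTimeDerivInL2 f fun t x => -c * g t x + F t x)
    {t : ℝ} (ht : 0 < t) {a b : ℝ} (ha : a + c * t ∈ Ioo (0 : ℝ) 1)
    (hb : b + c * t ∈ Ioo (0 : ℝ) 1) :
    HasDerivAt (fun s => ∫ x in (a + c * s)..(b + c * s), f s x)
      (∫ x in (a + c * t)..(b + c * t), F t x) t := by
  have h0 : (0 : ℝ) ∈ Icc (0 : ℝ) 1 := by simp
  have hmem : ∀ a, a + c * t ∈ Ioo (0 : ℝ) 1 → ∀ᶠ s in 𝓝 t, a + c * s ∈ Icc (0 : ℝ) 1 := by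
    intro a ha
    have hX : Continuous fun s => a + c * s := by fun_prop
    filter_upwards [hX.continuousAt.eventually_mem (isOpen_Ioo.mem_nhds ha)] with s hs
    exact Ioo_subset_Icc_self hs
  have h := (hf.hasDerivAt_integral_zero_moving hF hft ht hb).sub
    (hf.hasDerivAt_integral_zero_moving hF hft ht ha)
  have hFi : ∀ a, a + c * t ∈ Ioo (0 : ℝ) 1 → IntervalIntegrable (F t) volume 0 (a + c * t) :=
    fun a ha => (hF t ht.le).memLp_two_unitInterval.intervalIntegrable_unitInterval h0
      (Ioo_subset_Icc_self ha)
  rw [add_sub_add_left_eq_sub, intervalIntegral.integral_interval_sub_left (hFi b hb) (hFi a ha)]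
    at h
  refine h.congr_of_eventuallyEq ?_
  filter_upwards [hmem a ha, hmem b hb, lt_mem_nhds ht] with s has hbs hs
  have hfs := (hf.continuousOn_section hs.le).memLp_two_unitInterval
  exact (intervalIntegral.integral_interval_sub_left (hfs.intervalIntegrable_unitInterval h0 hbs)
    (hfs.intervalIntegrable_unitInterval h0 has)).symm

end IsContinuousInH1

/-! ### Weighted estimates along characteristics. -/

namespace IsContinuousInH1

variable {f g : ℝ → ℝ → ℝ}

/-- The parameter `r` is the distance travelled to the right, so time runs as `t₀ + c⁻¹ * r`,
backwards if `c < 0`; both transport directions are treated at once. Integrating the weight `exp (L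
* (1 - x))` towards `x = 1` gains the factor `1 / L`. -/
theorem abs_integral_moving_sub_le (hf : IsContinuousInH1 f g) {c : ℝ} (hc : c ≠ 0)
    {F : ℝ → ℝ → ℝ} (hF : ∀ t, 0 ≤ t → ContinuousOn (F t) (Icc 0 1))
    (hft : HasTimeDerivInL2 f fun t x => -c * g t x + F t x)
    {t₀ x₀ ρ ε K L : ℝ} (hx₀ : 0 < x₀) (hρ : 0 ≤ ρ) (hε : 0 ≤ ε) (hx₁ : x₀ + ρ + ε < 1)
    (hK : 0 ≤ K) (hL : 0 < L) (ht : ∀ r ∈ Icc 0 ρ, 0 < t₀ + c⁻¹ * r)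
    (hFK : ∀ r ∈ Icc 0 ρ, ∀ x, x₀ + r ≤ x → x < 1 →
      |F (t₀ + c⁻¹ * r) x| ≤ K * Real.exp (L * (1 - x))) :
    |(∫ x in (x₀ + ρ)..(x₀ + ε + ρ), f (t₀ + c⁻¹ * ρ) x) - ∫ x in x₀..(x₀ + ε), f t₀ x|
      ≤ |c⁻¹| * K / L * Real.exp (L * (1 - x₀)) * ε := by
  set ψ : ℝ → ℝ := fun r => ∫ x in (x₀ + r)..(x₀ + ε + r), f (t₀ + c⁻¹ * r) x with hψ
  set ψ' : ℝ → ℝ := fun r => (∫ x in (x₀ + r)..(x₀ + ε + r), F (t₀ + c⁻¹ * r) x) * c⁻¹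
  have hshift : ∀ z r : ℝ, z - c * t₀ + c * (t₀ + c⁻¹ * r) = z + r := by
    intro z r; field_simp; ring
  have hd : ∀ r ∈ Icc 0 ρ, HasDerivAt ψ (ψ' r) r := by
    intro r hr
    have h1 := hf.hasDerivAt_integral_moving hF hft (ht r hr) (a := x₀ - c * t₀)
      (b := x₀ + ε - c * t₀) (by rw [hshift]; constructor <;> linarith [hr.1, hr.2])
      (by rw [hshift]; constructor <;> linarith [hr.1, hr.2])
    have h2 : HasDerivAt (fun r => t₀ + c⁻¹ * r) c⁻¹ r := by
      simpa using ((hasDerivAt_id r).const_mul c⁻¹).const_add t₀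
    have h3 := h1.comp r h2
    simp only [Function.comp_def, hshift] at h3
    exact h3
  have hbound : ∀ r ∈ Ico 0 ρ, ‖ψ' r‖ ≤ |c⁻¹| * K * Real.exp (L * (1 - x₀ - r)) * ε := by
    intro r hr
    have h1 : ‖∫ x in (x₀ + r)..(x₀ + ε + r), F (t₀ + c⁻¹ * r) x‖
        ≤ K * Real.exp (L * (1 - x₀ - r)) * |x₀ + ε + r - (x₀ + r)| := by
      refine intervalIntegral.norm_integral_le_of_norm_le_const fun x hx => ?_
      rw [uIoc_of_le (by linarith)] at hx
      refine (hFK r (Ico_subset_Icc_self hr) x hx.1.le (by linarith [hx.2, hr.2])).trans ?_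
      exact mul_le_mul_of_nonneg_left (Real.exp_le_exp.2
        (mul_le_mul_of_nonneg_left (by linarith [hx.1]) hL.le)) hK
    have h2 : |x₀ + ε + r - (x₀ + r)| = ε := by
      rw [show x₀ + ε + r - (x₀ + r) = ε by ring, abs_of_nonneg hε]
    rw [h2] at h1
    calc ‖ψ' r‖ = ‖∫ x in (x₀ + r)..(x₀ + ε + r), F (t₀ + c⁻¹ * r) x‖ * |c⁻¹| := norm_mul _ _
      _ ≤ (K * Real.exp (L * (1 - x₀ - r)) * ε) * |c⁻¹| := by gcongr
      _ = _ := by ring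
  -- The antiderivative of the bound on `ψ'` that vanishes at `r = 0`; its negative term is dropped
  -- at the end.
  have hB : ∀ r, HasDerivAt (fun r => |c⁻¹| * K / L * ε *
      (Real.exp (L * (1 - x₀)) - Real.exp (L * (1 - x₀ - r))))
      (|c⁻¹| * K * Real.exp (L * (1 - x₀ - r)) * ε) r := by
    intro r
    have h1 : HasDerivAt (fun r => L * (1 - x₀ - r)) (-L) r := by
      simpa using ((hasDerivAt_id r).const_sub (1 - x₀)).const_mul L
    refine ((h1.exp.const_sub (Real.exp (L * (1 - x₀)))).const_mul
      (|c⁻¹| * K / L * ε)).congr_deriv ?_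
    field_simp
  have := image_norm_le_of_norm_deriv_right_le_deriv_boundary (f := fun r => ψ r - ψ 0) (f' := ψ')
    (a := 0) (b := ρ)
    (fun r hr => ((hd r hr).continuousAt.continuousWithinAt).sub continuousWithinAt_const)
    (fun r hr => ((hd r (Ico_subset_Icc_self hr)).sub_const (ψ 0)).hasDerivWithinAt)
    (by simp) hB hbound (x := ρ) ⟨hρ, le_rfl⟩
  have h0 : ψ 0 = ∫ x in x₀..(x₀ + ε), f t₀ x := by simp [hψ]
  rw [h0] at this
  refine this.trans ?_
  have : 0 ≤ |c⁻¹| * K / L * ε * Real.exp (L * (1 - x₀ - ρ)) := by positivity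
  linarith

/-- The window estimate is divided by the width `ε`, and `ε → 0` from the right. -/
theorem abs_sub_le_along_characteristic (hf : IsContinuousInH1 f g) {c : ℝ} (hc : c ≠ 0)
    {F : ℝ → ℝ → ℝ} (hF : ∀ t, 0 ≤ t → ContinuousOn (F t) (Icc 0 1))
    (hft : HasTimeDerivInL2 f fun t x => -c * g t x + F t x)
    {t₀ x₀ ρ K L : ℝ} (hx₀ : 0 < x₀) (hρ : 0 ≤ ρ) (hx₁ : x₀ + ρ < 1)
    (hK : 0 ≤ K) (hL : 0 < L) (ht : ∀ r ∈ Icc 0 ρ, 0 < t₀ + c⁻¹ * r)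
    (hFK : ∀ r ∈ Icc 0 ρ, ∀ x, x₀ + r ≤ x → x < 1 →
      |F (t₀ + c⁻¹ * r) x| ≤ K * Real.exp (L * (1 - x))) :
    |f (t₀ + c⁻¹ * ρ) (x₀ + ρ) - f t₀ x₀| ≤ |c⁻¹| * K / L * Real.exp (L * (1 - x₀)) := by
  have hI : ∀ t x, 0 < t → x ∈ Ioo (0 : ℝ) 1 →
      HasDerivAt (fun ε => ∫ y in x..(x + ε), f t y) (f t x) 0 := by
    intro t x ht hx
    have hcont := hf.continuousOn_section ht.le
    have h1 : HasDerivAt (fun z => ∫ y in x..z, f t y) (f t x) (x + 0) := by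
      rw [add_zero]
      exact intervalIntegral.integral_hasDerivAt_right (by simp)
        ((hcont.mono Ioo_subset_Icc_self).stronglyMeasurableAtFilter isOpen_Ioo _ hx)
        (hcont.continuousAt (Icc_mem_nhds hx.1 hx.2))
    exact h1.comp_const_add x 0
  have ht₁ := ht ρ ⟨hρ, le_rfl⟩
  have ht₀ : 0 < t₀ := by simpa using ht 0 ⟨le_rfl, hρ⟩
  have hD := (hI _ (x₀ + ρ) ht₁ ⟨by linarith, hx₁⟩).sub (hI _ x₀ ht₀ ⟨hx₀, by linarith⟩)
  have hs := (hasDerivAt_iff_tendsto_slope.1 hD).mono_left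
    (nhdsWithin_mono 0 (fun z (hz : 0 < z) => hz.ne') : 𝓝[>] (0 : ℝ) ≤ 𝓝[≠] 0)
  refine le_of_tendsto hs.norm ?_
  have hsmall : ∀ᶠ ε : ℝ in 𝓝[>] 0, x₀ + ρ + ε < 1 := by
    have : ∀ᶠ ε : ℝ in 𝓝 0, ε < 1 - (x₀ + ρ) := gt_mem_nhds (by linarith)
    filter_upwards [this.filter_mono nhdsWithin_le_nhds] with ε hε
    linarith
  filter_upwards [hsmall, self_mem_nhdsWithin] with ε hε hε0
  rw [mem_Ioi] at hε0
  have := hf.abs_integral_moving_sub_le hc hF hft hx₀ hρ hε0.le hε hK hL ht hFK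
  rw [show x₀ + ε + ρ = x₀ + ρ + ε by ring] at this
  simp only [slope_def_field, Pi.sub_apply, add_zero, intervalIntegral.integral_same, sub_zero,
    Real.norm_eq_abs, abs_div, abs_of_pos hε0]
  rwa [div_le_iff₀ hε0]

/-- The preceding estimate needs interior points and positive times, so the endpoint `x = 1` is
reached as a limit, by joint continuity up to the boundary. -/
theorem abs_le_of_characteristic_ends_at_zero (hf : IsContinuousInH1 f g) {c : ℝ} (hc : c ≠ 0)
    {F : ℝ → ℝ → ℝ} (hF : ∀ t, 0 ≤ t → ContinuousOn (F t) (Icc 0 1))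
    (hft : HasTimeDerivInL2 f fun t x => -c * g t x + F t x)
    {t₀ x₀ K L : ℝ} (hx₀ : 0 < x₀) (hx₁ : x₀ < 1)
    (hK : 0 ≤ K) (hL : 0 < L) (ht : ∀ r ∈ Ico 0 (1 - x₀), 0 < t₀ + c⁻¹ * r)
    (hFK : ∀ r ∈ Ico 0 (1 - x₀), ∀ x, x₀ + r ≤ x → x < 1 →
      |F (t₀ + c⁻¹ * r) x| ≤ K * Real.exp (L * (1 - x)))
    (hend : f (t₀ + c⁻¹ * (1 - x₀)) 1 = 0) :
    |f t₀ x₀| ≤ |c⁻¹| * K / L * Real.exp (L * (1 - x₀)) := by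
  have hX : Continuous fun r => (t₀ + c⁻¹ * r, x₀ + r) := by fun_prop
  have hmem : ∀ᶠ r in 𝓝[<] (1 - x₀), r ∈ Ico 0 (1 - x₀) := Ico_mem_nhdsLT (by linarith)
  have hlim0 : Tendsto (fun r => (t₀ + c⁻¹ * r, x₀ + r)) (𝓝[<] (1 - x₀))
      (𝓝 (t₀ + c⁻¹ * (1 - x₀), x₀ + (1 - x₀))) :=
    hX.continuousAt.tendsto.mono_left nhdsWithin_le_nhds
  have hend0 : 0 ≤ t₀ + c⁻¹ * (1 - x₀) := by
    refine ge_of_tendsto ((continuous_fst.tendsto _).comp hlim0) ?_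
    filter_upwards [hmem] with r hr using (ht r hr).le
  have hlim : Tendsto (fun r => f (t₀ + c⁻¹ * r) (x₀ + r)) (𝓝[<] (1 - x₀)) (𝓝 0) := by
    rw [add_sub_cancel] at hlim0
    have h := hf.continuousOn_uncurry (t₀ + c⁻¹ * (1 - x₀), 1) ⟨hend0, by simp⟩
    have h' := h.tendsto.comp (tendsto_nhdsWithin_iff.2 ⟨hlim0, by
      filter_upwards [hmem] with r hr
      exact ⟨(ht r hr).le, by linarith [hr.1], by linarith [hr.2]⟩⟩)
    simpa [hend, Function.comp_def] using h'
  have hle := (hlim.sub_const (f t₀ x₀)).norm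
  rw [zero_sub, norm_neg] at hle
  refine le_of_tendsto hle ?_
  filter_upwards [hmem] with ρ hρ
  exact hf.abs_sub_le_along_characteristic hc hF hft hx₀ hρ.1 (by linarith [hρ.2]) hK hL
    (fun r hr => ht r ⟨hr.1, hr.2.trans_lt hρ.2⟩) (fun r hr => hFK r ⟨hr.1, hr.2.trans_lt hρ.2⟩)

end IsContinuousInH1

/-! ### Domain of determination of data at the right end. -/

theorem ContinuousOn.matrix_mulVec_apply {m n : Type*} [Fintype n] {A : ℝ → Matrix m n ℝ}
    {w : ℝ → n → ℝ} {s : Set ℝ} (hA : ContinuousOn A s) (hw : ContinuousOn w s) (k : m) :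
    ContinuousOn (fun x => (A x *ᵥ w x) k) s := by
  simp only [Matrix.mulVec, dotProduct]
  exact continuousOn_finsetSum _ fun j _ => ((continuous_apply_apply k j).comp_continuousOn hA).mul
    (continuousOn_pi.1 hw j)

/-- Domain of determination: a hyperbolic system whose characteristics have slopes
`dt/dx ∈ [-α, β]` and whose solution vanishes at `x = 1` during `[a, b]` vanishes on the
trapezoid `a + α (1 - x) ≤ t ≤ b - β (1 - x)`. -/
theorem eq_zero_of_eq_zero_right {ι : Type*} [Fintype ι] {w g : ι → ℝ → ℝ → ℝ} {c : ι → ℝ}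
    {A : ℝ → Matrix ι ι ℝ} (hA : ContinuousOn A (Icc 0 1)) (hc : ∀ k, c k ≠ 0)
    (hw : ∀ k, IsContinuousInH1 (w k) (g k))
    (hwt : ∀ k, HasTimeDerivInL2 (w k)
      fun t x => -c k * g k t x + (A x *ᵥ fun j => w j t x) k)
    {a b α β : ℝ} (ha : 0 ≤ a) (hα : 0 < α) (hβ : 0 ≤ β) (hcα : ∀ k, -α ≤ (c k)⁻¹)
    (hcβ : ∀ k, (c k)⁻¹ ≤ β) (h1 : ∀ k, ∀ t ∈ Icc a b, w k t 1 = 0) (k : ι) {x t : ℝ}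
    (hx : x ∈ Icc (0 : ℝ) 1) (ht : t ∈ Icc (a + α * (1 - x)) (b - β * (1 - x))) :
    w k t x = 0 := by
  have hAe : ∀ k j, ContinuousOn (fun x => A x k j) (Icc 0 1) := fun k j =>
    (continuous_apply_apply k j).comp_continuousOn hA
  have hF : ∀ k, ∀ t, 0 ≤ t →
      ContinuousOn (fun x => (A x *ᵥ fun j => w j t x) k) (Icc 0 1) :=
    fun k t ht => hA.matrix_mulVec_apply
      (continuousOn_pi.2 fun j => (hw j).continuousOn_section ht) k
  obtain ⟨C, hC0, hC⟩ : ∃ C : ℝ, 0 < C ∧ ∀ k, ∀ x ∈ Icc (0 : ℝ) 1, ∑ j, |A x k j| ≤ C := by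
    have : ContinuousOn (fun x k => ∑ j, |A x k j|) (Icc 0 1) :=
      continuousOn_pi.2 fun k => continuousOn_finsetSum _ fun j _ => (hAe k j).abs
    obtain ⟨C, hC⟩ := isCompact_Icc.exists_bound_of_continuousOn this
    refine ⟨max C 1, by positivity, fun k x hx => le_max_of_le_left ?_⟩
    exact (le_abs_self _).trans ((norm_le_pi_norm _ k).trans (hC x hx))
  obtain ⟨M, hM⟩ : ∃ M : ℝ, ∀ k, ∀ t ∈ Icc 0 b, ∀ x ∈ Icc (0 : ℝ) 1, |w k t x| ≤ M := by
    have : ContinuousOn (fun (p : ℝ × ℝ) k => w k p.1 p.2) (Icc 0 b ×ˢ Icc 0 1) :=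
      continuousOn_pi.2 fun k => (hw k).continuousOn_uncurry.mono
        (prod_mono Icc_subset_Ici_self subset_rfl)
    obtain ⟨M, hM⟩ := (isCompact_Icc.prod isCompact_Icc).exists_bound_of_continuousOn this
    exact ⟨M, fun k t ht x hx => (norm_le_pi_norm _ k).trans (hM (t, x) ⟨ht, hx⟩)⟩
  set κ := α + β
  have hκ0 : 0 < κ := by positivity
  have hcκ : ∀ k, |(c k)⁻¹| ≤ κ := fun k =>
    abs_le.2 ⟨by linarith [hcα k], by linarith [hcβ k]⟩
  -- With this weight the factor `κ * C / L` gained along a characteristic is `1 / 2`.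
  set L := 2 * κ * C with hL
  have hL0 : 0 < L := by positivity
  -- Contraction in the weighted sup norm: a bound on the trapezoid improves itself by the factor `1
  -- / 2`.
  have step : ∀ M, 0 ≤ M →
      (∀ k, ∀ x ∈ Ioo (0 : ℝ) 1, ∀ t ∈ Icc (a + α * (1 - x)) (b - β * (1 - x)),
        |w k t x| ≤ M * Real.exp (L * (1 - x))) →
      (∀ k, ∀ x ∈ Ioo (0 : ℝ) 1, ∀ t ∈ Icc (a + α * (1 - x)) (b - β * (1 - x)),
        |w k t x| ≤ M / 2 * Real.exp (L * (1 - x))) := by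
    intro M hM0 hM k x₀ hx₀ t₀ ht₀
    -- Followed to the right, a characteristic stays in the trapezoid, because its slope lies in
    -- `[-α, β]`.
    have hlow : ∀ r, 0 ≤ r → a + α * (1 - x₀ - r) ≤ t₀ + (c k)⁻¹ * r := fun r hr => by
      nlinarith [mul_le_mul_of_nonneg_right (hcα k) hr, ht₀.1]
    have hup : ∀ r, 0 ≤ r → t₀ + (c k)⁻¹ * r ≤ b - β * (1 - x₀ - r) := fun r hr => by
      nlinarith [mul_le_mul_of_nonneg_right (hcβ k) hr, ht₀.2]
    -- Here `0 < α` matters: even if `a = 0`, times are positive before `x = 1`, and the equations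
    -- hold only for positive times.
    have hpos : ∀ r ∈ Ico 0 (1 - x₀), 0 < t₀ + (c k)⁻¹ * r := fun r hr =>
      lt_of_lt_of_le (by have := mul_pos hα (sub_pos.2 hr.2); linarith) (hlow r hr.1)
    have key := (hw k).abs_le_of_characteristic_ends_at_zero (hc k) (hF k) (hwt k) (K := C * M)
      hx₀.1 hx₀.2 (by positivity) hL0 hpos ?_ ?_
    · refine key.trans (mul_le_mul_of_nonneg_right ?_ (Real.exp_pos _).le)
      rw [div_le_iff₀ hL0, hL]
      calc |(c k)⁻¹| * (C * M) ≤ κ * (C * M) := by gcongr; exact hcκ k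
        _ = _ := by ring
    · intro r hr x hrx hx1
      have hxm : x ∈ Ioo (0 : ℝ) 1 := ⟨by linarith [hr.1, hx₀.1], hx1⟩
      have hxr : 1 - x ≤ 1 - x₀ - r := by linarith
      have hwb : ∀ j, |w j (t₀ + (c k)⁻¹ * r) x| ≤ M * Real.exp (L * (1 - x)) := fun j =>
        hM j x hxm _ ⟨(by gcongr : _ ≤ a + α * (1 - x₀ - r)).trans (hlow r hr.1),
          (hup r hr.1).trans (by gcongr)⟩
      simp only [Matrix.mulVec, dotProduct]
      calc |∑ j, A x k j * w j (t₀ + (c k)⁻¹ * r) x|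
          ≤ ∑ j, |A x k j| * (M * Real.exp (L * (1 - x))) := by
            refine (Finset.abs_sum_le_sum_abs _ _).trans (Finset.sum_le_sum fun j _ => ?_)
            rw [abs_mul]
            gcongr
            exact hwb j
        _ = (∑ j, |A x k j|) * (M * Real.exp (L * (1 - x))) := by rw [Finset.sum_mul]
        _ ≤ C * (M * Real.exp (L * (1 - x))) := by
            gcongr; exact hC k x (Ioo_subset_Icc_self hxm)
        _ = _ := by ring
    · have h := sub_nonneg.2 hx₀.2.le
      exact h1 k _ ⟨by simpa using hlow _ h, by simpa using hup _ h⟩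
  have hiter : ∀ n : ℕ, ∀ k, ∀ x ∈ Ioo (0 : ℝ) 1,
      ∀ t ∈ Icc (a + α * (1 - x)) (b - β * (1 - x)),
        |w k t x| ≤ |M| / 2 ^ n * Real.exp (L * (1 - x)) := by
    intro n
    induction n with
    | zero =>
      intro k x hx t ht
      have hα' : 0 ≤ α * (1 - x) := mul_nonneg hα.le (by linarith [hx.2])
      have hβ' : 0 ≤ β * (1 - x) := mul_nonneg hβ (by linarith [hx.2])
      have hle := hM k t ⟨by linarith [ht.1], by linarith [ht.2]⟩ x (Ioo_subset_Icc_self hx)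
      have hexp : 1 ≤ Real.exp (L * (1 - x)) :=
        Real.one_le_exp (mul_nonneg hL0.le (by linarith [hx.2]))
      rw [pow_zero, div_one]
      nlinarith [le_abs_self M, abs_nonneg M]
    | succ n ih =>
      have := step _ (by positivity) ih
      simpa only [pow_succ, ← div_div] using this
  have hint : ∀ x ∈ Ioo (0 : ℝ) 1, ∀ t ∈ Icc (a + α * (1 - x)) (b - β * (1 - x)),
      w k t x = 0 := by
    intro x hx t ht
    have hlim : Tendsto (fun n : ℕ => |M| / 2 ^ n * Real.exp (L * (1 - x))) atTop (𝓝 0) := by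
      simpa [div_eq_mul_inv] using ((tendsto_pow_atTop_nhds_zero_of_lt_one
        (by norm_num : (0 : ℝ) ≤ 2⁻¹) (by norm_num)).const_mul |M|).mul_const
          (Real.exp (L * (1 - x)))
    exact abs_nonpos_iff.1 (ge_of_tendsto' hlim fun n => hiter n k x hx t ht)
  rcases eq_or_lt_of_le hx.2 with rfl | hx1
  · exact h1 k t (by simpa using ht)
  rcases eq_or_lt_of_le hx.1 with rfl | hx0
  -- The estimates are interior, so `x = 0` follows by continuity; the trapezoid widens with `x` and
  -- contains the segment at time `t`.
  · have ht0 : 0 ≤ t := by linarith [ht.1]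
    have hlim := (((hw k).continuousOn_section ht0) 0 hx).tendsto.mono_left
      (nhdsWithin_mono 0 Ioo_subset_Icc_self)
    rw [nhdsWithin_Ioo_eq_nhdsGT zero_lt_one] at hlim
    refine tendsto_nhds_unique hlim (tendsto_const_nhds.congr' ?_)
    filter_upwards [Ioo_mem_nhdsGT (zero_lt_one (α := ℝ))] with x hx
    refine (hint x hx t ⟨le_trans ?_ ht.1, ht.2.trans ?_⟩).symm <;> gcongr <;> linarith [hx.1]
  · exact hint x ⟨hx0, hx1⟩ t ht

/-! ### Differences of solutions, the rank condition and sums of travel times. -/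

theorem tendsto_eLpNorm_sub {l : Filter ℝ} {d e : ℝ → ℝ → ℝ}
    (hd : ∀ᶠ s in l, AEStronglyMeasurable (d s) (volume.restrict (Icc (0 : ℝ) 1)))
    (he : ∀ᶠ s in l, AEStronglyMeasurable (e s) (volume.restrict (Icc (0 : ℝ) 1)))
    (hd0 : Tendsto (fun s => eLpNorm (d s) 2 (volume.restrict (Icc (0 : ℝ) 1))) l (𝓝 0))
    (he0 : Tendsto (fun s => eLpNorm (e s) 2 (volume.restrict (Icc (0 : ℝ) 1))) l (𝓝 0)) :
    Tendsto (fun s => eLpNorm (d s - e s) 2 (volume.restrict (Icc (0 : ℝ) 1))) l (𝓝 0) := by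
  have h := hd0.add he0
  rw [add_zero] at h
  refine tendsto_of_tendsto_of_tendsto_of_le_of_le' tendsto_const_nhds h
    (Eventually.of_forall fun _ => zero_le) ?_
  filter_upwards [hd, he] with s h1 h2
  exact eLpNorm_sub_le h1 h2 (by norm_num)

theorem IsContinuousInH1.sub {f g f' g' : ℝ → ℝ → ℝ} (h : IsContinuousInH1 f g)
    (h' : IsContinuousInH1 f' g') : IsContinuousInH1 (f - f') (g - g') where
  memLp t ht := (h.memLp t ht).sub (h'.memLp t ht)
  eq_integral t ht x hx := by
    have h0 : (0 : ℝ) ∈ Icc (0 : ℝ) 1 := by simp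
    simp only [Pi.sub_apply]
    rw [intervalIntegral.integral_sub ((h.memLp t ht).intervalIntegrable_unitInterval h0 hx)
      ((h'.memLp t ht).intervalIntegrable_unitInterval h0 hx), h.eq_integral t ht x hx,
      h'.eq_integral t ht x hx]
    ring
  continuous t ht := by
    refine (tendsto_eLpNorm_sub ?_ ?_ (h.continuous t ht) (h'.continuous t ht)).congr fun s => ?_
    · filter_upwards [self_mem_nhdsWithin] with s hs
      exact ((h.continuousOn_section hs).sub
        (h.continuousOn_section ht)).memLp_two_unitInterval.aestronglyMeasurable
    · filter_upwards [self_mem_nhdsWithin] with s hs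
      exact ((h'.continuousOn_section hs).sub
        (h'.continuousOn_section ht)).memLp_two_unitInterval.aestronglyMeasurable
    · congr 1; ext x; simp only [Pi.sub_apply]; ring
  continuous_deriv t ht := by
    refine (tendsto_eLpNorm_sub ?_ ?_ (h.continuous_deriv t ht)
      (h'.continuous_deriv t ht)).congr fun s => ?_
    · filter_upwards [self_mem_nhdsWithin] with s hs
      exact ((h.memLp s hs).sub (h.memLp t ht)).aestronglyMeasurable
    · filter_upwards [self_mem_nhdsWithin] with s hs
      exact ((h'.memLp s hs).sub (h'.memLp t ht)).aestronglyMeasurable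
    · congr 1; ext x; simp only [Pi.sub_apply]; ring

theorem HasTimeDerivInL2.sub {f h f' h' : ℝ → ℝ → ℝ} (hf : HasTimeDerivInL2 f h)
    (hf' : HasTimeDerivInL2 f' h') (hfc : ∀ t, 0 ≤ t → ContinuousOn (f t) (Icc 0 1))
    (hfc' : ∀ t, 0 ≤ t → ContinuousOn (f' t) (Icc 0 1))
    (hh : ∀ t, 0 ≤ t → MemLp (h t) 2 (volume.restrict (Icc (0 : ℝ) 1)))
    (hh' : ∀ t, 0 ≤ t → MemLp (h' t) 2 (volume.restrict (Icc (0 : ℝ) 1))) :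
    HasTimeDerivInL2 (f - f') (h - h') := by
  intro t ht
  have hpos : ∀ᶠ s in 𝓝[≠] t, 0 < s := (lt_mem_nhds ht).filter_mono nhdsWithin_le_nhds
  refine (tendsto_eLpNorm_sub ?_ ?_ (hf t ht) (hf' t ht)).congr fun s => ?_
  · filter_upwards [hpos] with s hs
    exact ((((hfc s hs.le).sub (hfc t ht.le)).memLp_two_unitInterval.const_mul _).sub
      (hh t ht.le)).aestronglyMeasurable
  · filter_upwards [hpos] with s hs
    exact ((((hfc' s hs.le).sub (hfc' t ht.le)).memLp_two_unitInterval.const_mul _).sub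
      (hh' t ht.le)).aestronglyMeasurable
  · congr 1; ext x; simp only [Pi.sub_apply]; ring

theorem Matrix.mulVec_injective_of_rank_eq {m n : Type*} [Fintype m] [Fintype n]
    {A : Matrix m n ℝ} (hA : A.rank = Fintype.card n) :
    Function.Injective A.mulVec := by
  have h := A.mulVecLin.finrank_range_add_finrank_ker
  have hr : Module.finrank ℝ A.mulVecLin.range = Fintype.card n := hA
  rw [hr, Module.finrank_fintype_fun_eq_card, Nat.add_eq_left, Submodule.finrank_eq_zero] at h
  exact LinearMap.ker_eq_bot.1 h

theorem Fin.sum_Ioi_eq_sum_Ici_succ {N : ℕ} {i j : Fin N} (hij : j.val = i.val + 1) (f : Fin N → ℝ) :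
    ∑ l ∈ Finset.Ioi i, f l = ∑ l ∈ Finset.Ici j, f l := by
  congr 1
  ext l
  simp only [Finset.mem_Ioi, Finset.mem_Ici, Fin.lt_def, Fin.le_def]
  omega

theorem Fin.sum_Ici_eq_add_sum_Ioi {N : ℕ} (i : Fin N) (f : Fin N → ℝ) :
    ∑ l ∈ Finset.Ici i, f l = f i + ∑ l ∈ Finset.Ioi i, f l := by
  rw [← Finset.Ioi_insert, Finset.sum_insert (by simp)]

/-! ### Observability of the chain. -/

namespace HyperbolicChain

variable {S : HyperbolicChain}

namespace IsSolution

variable {U U' : ℝ → Fin (S.n S.first) → ℝ} {u u' : S.RightState} {v v' : S.LeftState}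

theorem continuousOn_right (h : S.IsSolution U u v) (i : Fin S.N) {t : ℝ} (ht : 0 ≤ t) :
    ContinuousOn (u i t) (Icc 0 1) :=
  continuousOn_pi.2 fun k => (h.pde_u i k).choose_spec.1.continuousOn_section ht

theorem continuousOn_left (h : S.IsSolution U u v) (i : Fin S.N) {t : ℝ} (ht : 0 ≤ t) :
    ContinuousOn (v i t) (Icc 0 1) :=
  continuousOn_pi.2 fun k => (h.pde_v i k).choose_spec.1.continuousOn_section ht

theorem memLp_source_right (h : S.IsSolution U u v) (i : Fin S.N) (k : Fin (S.n i)) {t : ℝ}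
    (ht : 0 ≤ t) : MemLp (fun x => (S.Spp i x *ᵥ u i t x + S.Spm i x *ᵥ v i t x) k) 2
      (volume.restrict (Icc (0 : ℝ) 1)) :=
  (((S.Spp_cont i).matrix_mulVec_apply (h.continuousOn_right i ht) k).add
    ((S.Spm_cont i).matrix_mulVec_apply (h.continuousOn_left i ht) k)).memLp_two_unitInterval

theorem memLp_source_left (h : S.IsSolution U u v) (i : Fin S.N) (k : Fin (S.m i)) {t : ℝ}
    (ht : 0 ≤ t) : MemLp (fun x => (S.Smp i x *ᵥ u i t x + S.Smm i x *ᵥ v i t x) k) 2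
      (volume.restrict (Icc (0 : ℝ) 1)) :=
  (((S.Smp_cont i).matrix_mulVec_apply (h.continuousOn_right i ht) k).add
    ((S.Smm_cont i).matrix_mulVec_apply (h.continuousOn_left i ht) k)).memLp_two_unitInterval

/-- The controls may differ: the propagation of zeros from the right end never uses the condition at
the controlled end. -/
theorem sub (h : S.IsSolution U u v) (h' : S.IsSolution U' u' v') :
    S.IsSolution (U - U') (u - u') (v - v') where
  pde_u i k := by
    obtain ⟨g, hg, hgt⟩ := h.pde_u i k
    obtain ⟨g', hg', hgt'⟩ := h'.pde_u i k
    refine ⟨g - g', hg.sub hg', ?_⟩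
    convert hgt.sub hgt' (fun t ht => hg.continuousOn_section ht)
      (fun t ht => hg'.continuousOn_section ht)
      (fun t ht => ((hg.memLp t ht).const_mul _).add (h.memLp_source_right i k ht))
      (fun t ht => ((hg'.memLp t ht).const_mul _).add (h'.memLp_source_right i k ht)) using 1
    · rfl
    · funext t x
      simp only [Pi.sub_apply, Pi.add_apply, Matrix.mulVec_sub]
      ring
  pde_v i k := by
    obtain ⟨g, hg, hgt⟩ := h.pde_v i k
    obtain ⟨g', hg', hgt'⟩ := h'.pde_v i k
    refine ⟨g - g', hg.sub hg', ?_⟩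
    convert hgt.sub hgt' (fun t ht => hg.continuousOn_section ht)
      (fun t ht => hg'.continuousOn_section ht)
      (fun t ht => ((hg.memLp t ht).const_mul _).add (h.memLp_source_left i k ht))
      (fun t ht => ((hg'.memLp t ht).const_mul _).add (h'.memLp_source_left i k ht)) using 1
    · rfl
    · funext t x
      simp only [Pi.sub_apply, Pi.add_apply, Matrix.mulVec_sub]
      ring
  bc_u_first t ht := by
    simp only [Pi.sub_apply, h.bc_u_first t ht, h'.bc_u_first t ht, Matrix.mulVec_sub]
    abel
  bc_u i j hij t ht := by
    simp only [Pi.sub_apply, h.bc_u i j hij t ht, h'.bc_u i j hij t ht, Matrix.mulVec_sub]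
    abel
  bc_v i j hij t ht := by
    simp only [Pi.sub_apply, h.bc_v i j hij t ht, h'.bc_v i j hij t ht, Matrix.mulVec_sub]
    abel
  bc_v_last t ht := by
    simp only [Pi.sub_apply, h.bc_v_last t ht, h'.bc_v_last t ht, Matrix.mulVec_sub]

/-- A subsystem at rest at its right end during `[a, b]` is at rest on a trapezoid. -/
theorem eq_zero_of_right_end (h : S.IsSolution U u v) (i : Fin S.N) {a b : ℝ} (ha : 0 ≤ a)
    (h1 : ∀ t ∈ Icc a b, u i t 1 = 0 ∧ v i t 1 = 0) {x t : ℝ} (hx : x ∈ Icc (0 : ℝ) 1)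
    (ht : t ∈ Icc (a + 1 / S.muMin i * (1 - x)) (b - 1 / S.lamMin i * (1 - x))) :
    u i t x = 0 ∧ v i t x = 0 := by
  choose ux hux huxt using h.pde_u i
  choose vx hvx hvxt using h.pde_v i
  have hlam : 0 < S.lamMin i := S.lam_pos i _
  have hmu : 0 < S.muMin i := S.mu_pos i _
  have hlamle : ∀ k, S.lamMin i ≤ S.lam i k := fun k =>
    (S.lam_strictMono i).monotone (Nat.zero_le k.val)
  have hmule : ∀ k, S.muMin i ≤ S.mu i k := fun k =>
    (S.mu_strictMono i).monotone (Nat.zero_le k.val)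
  -- Both directions are stacked into one system with speeds `lam` and `-mu`.
  set A : ℝ → Matrix (Fin (S.n i) ⊕ Fin (S.m i)) (Fin (S.n i) ⊕ Fin (S.m i)) ℝ := fun x =>
    Matrix.fromBlocks (S.Spp i x) (S.Spm i x) (S.Smp i x) (S.Smm i x)
  set w : Fin (S.n i) ⊕ Fin (S.m i) → ℝ → ℝ → ℝ :=
    Sum.elim (fun k t x => u i t x k) (fun k t x => v i t x k) with hw
  have hA : ContinuousOn A (Icc 0 1) := by
    have he : ∀ {m n : ℕ} {B : ℝ → Matrix (Fin m) (Fin n) ℝ}, ContinuousOn B (Icc 0 1) →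
        ∀ k j, ContinuousOn (fun x => B x k j) (Icc 0 1) := fun hB k j =>
      (continuous_apply_apply k j).comp_continuousOn hB
    refine continuousOn_pi.2 fun k => continuousOn_pi.2 fun j => ?_
    rcases k with k | k <;> rcases j with j | j
    · exact he (S.Spp_cont i) k j
    · exact he (S.Spm_cont i) k j
    · exact he (S.Smp_cont i) k j
    · exact he (S.Smm_cont i) k j
  have hAw : ∀ t x, (A x *ᵥ fun j => w j t x) =
      Sum.elim (S.Spp i x *ᵥ u i t x + S.Spm i x *ᵥ v i t x)
        (S.Smp i x *ᵥ u i t x + S.Smm i x *ᵥ v i t x) := by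
    intro t x
    have hwe : (fun j => w j t x) = Sum.elim (u i t x) (v i t x) := by
      ext (k | k) <;> rfl
    rw [hwe, Matrix.fromBlocks_mulVec]
    rfl
  have key : ∀ k, w k t x = 0 := by
    intro k
    refine eq_zero_of_eq_zero_right (w := w) (g := Sum.elim ux vx)
      (c := Sum.elim (S.lam i) fun k => -S.mu i k) hA ?_ ?_ ?_ ha (one_div_pos.2 hmu)
      (one_div_pos.2 hlam).le ?_ ?_ ?_ k hx ht
    · rintro (k | k)
      · exact (S.lam_pos i k).ne'
      · exact neg_ne_zero.2 (S.mu_pos i k).ne'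
    · rintro (k | k)
      · exact hux k
      · exact hvx k
    · rintro (k | k)
      · simp only [hAw]
        exact huxt k
      · simp only [hAw, Sum.elim_inr, neg_neg]
        exact hvxt k
    · rintro (k | k)
      · have := inv_pos.2 (S.lam_pos i k)
        have := one_div_pos.2 hmu
        simp only [Sum.elim_inl]
        linarith
      · rw [Sum.elim_inr, inv_neg, neg_le_neg_iff, ← one_div]
        exact one_div_le_one_div_of_le hmu (hmule k)
    · rintro (k | k)
      · simp only [Sum.elim_inl, ← one_div]
        exact one_div_le_one_div_of_le hlam (hlamle k)
      · have := inv_pos.2 (S.mu_pos i k)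
        have := one_div_pos.2 hlam
        simp only [Sum.elim_inr, inv_neg]
        linarith
    · rintro (k | k) s hs
      · exact congrFun (h1 s hs).1 k
      · exact congrFun (h1 s hs).2 k
  exact ⟨funext fun k => key (Sum.inl k), funext fun k => key (Sum.inr k)⟩

/-- If the output vanishes on `[0, T]`, then so do the traces of all states at the right ends, up
to the travel times through the subsystems further to the right. -/
theorem right_end_eq_zero (hQ : ∀ i j : Fin S.N, i.val = j.val + 1 → (S.Q i j).rank = S.n j)
    (h : S.IsSolution U u v) {T : ℝ} (hy : ∀ s ∈ Icc 0 T, S.output u s = 0) (i : Fin S.N) :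
    ∀ s ∈ Icc (∑ j ∈ Finset.Ioi i, 1 / S.muMin j) (T - ∑ j ∈ Finset.Ioi i, 1 / S.lamMin j),
      u i s 1 = 0 ∧ v i s 1 = 0 := by
  have hmu : ∀ i, 0 < 1 / S.muMin i := fun i => one_div_pos.2 (S.mu_pos i _)
  have hlam : ∀ i, 0 < 1 / S.lamMin i := fun i => one_div_pos.2 (S.lam_pos i _)
  have hmu0 : ∀ i : Fin S.N, 0 ≤ ∑ j ∈ Finset.Ioi i, 1 / S.muMin j := fun i =>
    Finset.sum_nonneg fun j _ => (hmu j).le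
  have hlam0 : ∀ i : Fin S.N, 0 ≤ ∑ j ∈ Finset.Ioi i, 1 / S.lamMin j := fun i =>
    Finset.sum_nonneg fun j _ => (hlam j).le
  -- Induction on the distance to the measured subsystem.
  induction hk : S.N - 1 - i.val generalizing i with
  | zero =>
    obtain rfl : i = S.last := Fin.ext (by have := i.isLt; simp only [last]; omega)
    intro s hs
    have hs0 : 0 ≤ s := (hmu0 _).trans hs.1
    have hu : u S.last s 1 = 0 := hy s ⟨hs0, by linarith [hs.2, hlam0 S.last]⟩
    exact ⟨hu, by rw [h.bc_v_last s hs0, hu, Matrix.mulVec_zero]⟩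
  | succ k ih =>
    have hj : i.val + 1 < S.N := by omega
    set j : Fin S.N := ⟨i.val + 1, hj⟩
    have hij : j.val = i.val + 1 := rfl
    have ihj := ih j (by omega)
    intro s hs
    rw [Fin.sum_Ioi_eq_sum_Ici_succ hij, Fin.sum_Ioi_eq_sum_Ici_succ hij, Fin.sum_Ici_eq_add_sum_Ioi,
      Fin.sum_Ici_eq_add_sum_Ioi] at hs
    have hs0 : 0 ≤ s := by linarith [hs.1, hmu j, hmu0 j]
    -- At `x = 0` the trapezoid has lost the full travel times of subsystem `j`, which are the new
    -- terms in the two sums.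
    have hleft := h.eq_zero_of_right_end j (hmu0 j) ihj (x := 0) (t := s) (by simp)
      ⟨by linarith [hs.1], by linarith [hs.2]⟩
    have hright := ihj s ⟨by linarith [hs.1, hmu j], by linarith [hs.2, hlam j]⟩
    have hu : u i s 1 = 0 := by
      have hb := h.bc_u j i hij s hs0
      rw [hleft.1, hleft.2, Matrix.mulVec_zero, zero_add] at hb
      refine Matrix.mulVec_injective_of_rank_eq (A := S.Q j i) (by simpa using hQ j i hij) ?_
      rw [← hb, Matrix.mulVec_zero]
    exact ⟨hu, by rw [h.bc_v i j hij s hs0, hu, hleft.2, Matrix.mulVec_zero, Matrix.mulVec_zero,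
      add_zero]⟩

/-- The output during `[0, t]` determines the state at time `t - τ`. -/
theorem eq_of_output_eq (hQ : ∀ i j : Fin S.N, i.val = j.val + 1 → (S.Q i j).rank = S.n j)
    {τ : ℝ} (hτ : ∑ j, 1 / S.lamMin j < τ) (h : S.IsSolution U u v) (h' : S.IsSolution U' u' v')
    {t : ℝ} (hy : ∀ s ∈ Icc 0 t, S.output u s = S.output u' s) (i : Fin S.N)
    (ht : τ + ∑ j ∈ Finset.Ici i, 1 / S.muMin j ≤ t) {x : ℝ} (hx : x ∈ Icc (0 : ℝ) 1) :
    u i (t - τ) x = u' i (t - τ) x ∧ v i (t - τ) x = v' i (t - τ) x := by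
  have hmu : ∀ i, 0 < 1 / S.muMin i := fun i => one_div_pos.2 (S.mu_pos i _)
  have hlam : ∀ i, 0 < 1 / S.lamMin i := fun i => one_div_pos.2 (S.lam_pos i _)
  have hle : ∑ j ∈ Finset.Ici i, 1 / S.lamMin j ≤ ∑ j, 1 / S.lamMin j :=
    Finset.sum_le_sum_of_subset_of_nonneg (Finset.subset_univ _) fun j _ _ => (hlam j).le
  rw [Fin.sum_Ici_eq_add_sum_Ioi] at ht hle
  have hd := h.sub h'
  have hend := hd.right_end_eq_zero hQ (T := t) (fun s hs => sub_eq_zero.2 (hy s hs)) i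
  -- The full travel times bound the loss at every `x`. The condition on `t` puts `t - τ` above the
  -- lower side of the trapezoid, and `hτ` puts it below the upper side.
  have hmx := mul_le_of_le_one_right (hmu i).le (by linarith [hx.1] : 1 - x ≤ 1)
  have hlx := mul_le_of_le_one_right (hlam i).le (by linarith [hx.1] : 1 - x ≤ 1)
  have hz := hd.eq_zero_of_right_end i (Finset.sum_nonneg fun j _ => (hmu j).le) hend hx
    (t := t - τ) ⟨by linarith, by linarith⟩
  exact ⟨sub_eq_zero.1 hz.1, sub_eq_zero.1 hz.2⟩

end IsSolution

/-! ### The estimator. -/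

/-- The trajectories of the system that are consistent with the output signal `y` up to time
`t`. -/
def ConsistentTrajectory (S : HyperbolicChain) (y : S.Signal) (t : ℝ)
    (p : S.RightState × S.LeftState) : Prop :=
  (∃ U, S.IsSolution U p.1 p.2) ∧ ∀ s ∈ Icc 0 t, y s = S.output p.1 s

/-- An equality of predicates, not only an equivalence, so that the choices made from them coincide;
this is causality. -/
theorem consistentTrajectory_congr {y y' : S.Signal} {t : ℝ} (h : ∀ s ∈ Icc 0 t, y s = y' s) :
    S.ConsistentTrajectory y t = S.ConsistentTrajectory y' t := by
  ext p
  exact and_congr_right fun _ => forall₂_congr fun s hs => by rw [h s hs]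

/-- A trajectory consistent with the output signal `y` up to time `t`, if there is one. -/
noncomputable def consistentTrajectory (S : HyperbolicChain) (y : S.Signal) (t : ℝ) :
    S.RightState × S.LeftState :=
  Classical.epsilon (S.ConsistentTrajectory y t)

theorem isCausal_consistentTrajectory (S : HyperbolicChain) (τ : ℝ) :
    S.IsCausal (fun y i t x => (S.consistentTrajectory y t).1 i (t - τ) x) ∧
    S.IsCausal (fun y i t x => (S.consistentTrajectory y t).2 i (t - τ) x) := by
  constructor <;> intro y y' t h i x _ <;>
    simp only [consistentTrajectory, consistentTrajectory_congr h]

end HyperbolicChain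

theorem mainTheorem7 (S : HyperbolicChain)
    (hQ : ∀ i j : Fin S.N, i.val = j.val + 1 → (S.Q i j).rank = S.n j)
    (τ : ℝ) (hτ : ∑ j, 1 / S.lamMin j < τ) :
    ∃ (uhat : S.Signal → S.RightState) (vhat : S.Signal → S.LeftState),
      S.IsCausal uhat ∧ S.IsCausal vhat ∧
      ∀ (U : ℝ → Fin (S.n S.first) → ℝ) (u : S.RightState) (v : S.LeftState),
        S.IsSolution U u v →
        ∀ (i : Fin S.N) (t : ℝ), τ + ∑ j ∈ Finset.Ici i, 1 / S.muMin j ≤ t →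
          ∀ x ∈ Icc (0 : ℝ) 1,
            uhat (S.output u) i t x = delayed τ (u i) t x ∧
            vhat (S.output u) i t x = delayed τ (v i) t x := by
  obtain ⟨hu, hv⟩ := S.isCausal_consistentTrajectory τ
  refine ⟨_, _, hu, hv, fun U u v h i t ht x hx => ?_⟩
  have hex : ∃ p, S.ConsistentTrajectory (S.output u) t p := ⟨(u, v), ⟨U, h⟩, fun _ _ => rfl⟩
  -- The true trajectory is a candidate, so the chosen one really reproduces the output, possibly
  -- with another control `U'`.
  obtain ⟨⟨U', h'⟩, hy⟩ := Classical.epsilon_spec hex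
  exact h'.eq_of_output_eq hQ hτ h (fun s hs => (hy s hs).symm) i ht hx
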